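/- For $k\in\mathbb{N}$, order $\{0,1\}^k$ coordinatewise. In the problem $\mathrm{TARSKI}(2,k)$ there is an unknown monotone function $f:\{0,1\}^k\to\{0,1\}^k$; an algorithm may adaptively query vertices $v$, each query revealing $f(v)$, and must output a vertex $x$ with $f(x)=x$. The deterministic query complexity $D(k)$ is the minimum, over all deterministic algorithms that find a fixed point of every monotone $f$, of the maximum over monotone $f$ of the number of queries made on $f$. The randomized query complexity $R(k)$ is the infimum, over all randomized algorithms that for every monotone $f$ find a fixed point with probability at least $9/10$, of the supremum over monotone $f$ of the expected number of queries made on $f$; here probability and expectation are over the coin tosses of the algorithm. Both the randomized and the deterministic query complexity of $\mathrm{TARSKI}(2,k)$ are $\Theta(k)$: there are constants $c,C>0$ such that for all $k\in\mathbb{N}$, $$c\,k\le R(k)\le C\,k\qquad\text{and}\qquad c\,k\le D(k)\le C\,k .$$ -/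

import Mathlib

open scoped NNReal ENNReal

namespace Tarski

/-- The grid `{0, …, n - 1}^k`; its order is the coordinatewise one. -/
abbrev Grid (n k : ℕ) : Type := Fin k → Fin n

/-- Deterministic query algorithms (decision trees) with oracle access to an unknown
`f : X → X`: either stop and output a vertex, or query a vertex `v` and continue
depending on the answer `f v`. -/
inductive QueryAlg (X : Type) : Type
  | output (x : X) : QueryAlg X
  | query (v : X) (next : X → QueryAlg X) : QueryAlg X

namespace QueryAlg

variable {X : Type}

/-- The output of the algorithm when the oracle is `f`. -/
def run (f : X → X) : QueryAlg X → X
  | output x => x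
  | query v next => run f (next (f v))

/-- The number of queries that the algorithm makes when the oracle is `f`. -/
def numQueries (f : X → X) : QueryAlg X → ℕ
  | output _ => 0
  | query v next => numQueries f (next (f v)) + 1

/-- The algorithm finds a fixed point of `f`. -/
def Succeeds (f : X → X) (T : QueryAlg X) : Prop :=
  Function.IsFixedPt f (T.run f)

end QueryAlg

/-- A randomized query algorithm: a random choice of a deterministic one. (There are only
countably many deterministic algorithms on a finite `X`, so every probability distribution
on them is a `PMF`.) -/
abbrev RandQueryAlg (X : Type) : Type := PMF (QueryAlg X)

namespace RandQueryAlg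

variable {X : Type}

/-- The probability, over the coin tosses of the algorithm, of finding a fixed point of `f`. -/
noncomputable def successProb (f : X → X) (A : RandQueryAlg X) : ℝ≥0∞ :=
  PMF.toOuterMeasure A {T | T.Succeeds f}

/-- The expected number of queries, over the coin tosses of the algorithm, on input `f`. -/
noncomputable def expectedQueries (f : X → X) (A : RandQueryAlg X) : ℝ≥0∞ :=
  ∑' T : QueryAlg X, A T * (T.numQueries f : ℝ≥0∞)

end RandQueryAlg

/-- The deterministic query complexity of `TARSKI(n, k)`: the worst-case number of queries of
the best deterministic algorithm that finds a fixed point of every monotone function. -/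
noncomputable def detQueryComplexity (n k : ℕ) : ℕ∞ :=
  ⨅ (T : QueryAlg (Grid n k)) (_ : ∀ f : Grid n k → Grid n k, Monotone f → T.Succeeds f),
    ⨆ (f : Grid n k → Grid n k) (_ : Monotone f), (T.numQueries f : ℕ∞)

/-- The randomized query complexity of `TARSKI(n, k)`: the worst-case expected number of
queries of the best randomized algorithm that, on every monotone function, finds a fixed point
with probability at least `9/10`. -/
noncomputable def randQueryComplexity (n k : ℕ) : ℝ≥0∞ :=
  ⨅ (A : RandQueryAlg (Grid n k))
    (_ : ∀ f : Grid n k → Grid n k, Monotone f → 9 / 10 ≤ A.successProb f),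
    ⨆ (f : Grid n k → Grid n k) (_ : Monotone f), A.expectedQueries f

end Tarski

/-! Upper bound: the iterates of a monotone map from `⊥` increase, so they are stationary after `k`
steps. Lower bound: take `hardFun a` with `a` uniform. A query at `v` tells only, for each value
`b`, which coordinate is the first where `v` is `b` and `a` is not. Scanning for it, each unknown
bit of `a` ends the scan with probability 1/2, so a query costs at most 2 + 2 = 4 unknown bits on
average. `card_mul_card_le_sum_cost` turns this into an induction over the decision tree, on
subcubes of candidates for `a`; averaging gives both lower bounds. -/

namespace Tarski

open Finset Function

/-! ### Upper bound: iteration from the bottom -/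

namespace QueryAlg

/-- Query the current vertex and move to the answer, `n` times. -/
def iterate {X : Type} : ℕ → X → QueryAlg X
  | 0, x => output x
  | n + 1, x => query x (iterate n)

theorem run_iterate {X : Type} (f : X → X) (n : ℕ) (x : X) :
    (iterate n x).run f = f^[n] x := by
  induction n generalizing x with
  | zero => rfl
  | succ n ih => exact ih (f x)

theorem numQueries_iterate {X : Type} (f : X → X) (n : ℕ) (x : X) :
    (iterate n x).numQueries f = n := by
  induction n generalizing x with
  | zero => rfl
  | succ n ih => exact congrArg (· + 1) (ih (f x))

end QueryAlg

theorem sum_val_lt_sum_val {n k : ℕ} {x y : Grid n k} (h : x < y) :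
    ∑ i, (x i : ℕ) < ∑ i, (y i : ℕ) := by
  obtain ⟨hle, i, hi⟩ := Pi.lt_def.1 h
  exact sum_lt_sum (fun j _ => hle j) ⟨i, mem_univ i, hi⟩

theorem isFixedPt_iterate_bot {k : ℕ} {f : Grid 2 k → Grid 2 k} (hf : Monotone f) :
    IsFixedPt f (f^[k] ⊥) := by
  have step (n : ℕ) : f^[n] ⊥ ≤ f^[n + 1] ⊥ := hf.monotone_iterate_of_le_map bot_le n.le_succ
  have key (n : ℕ) : IsFixedPt f (f^[n] ⊥) ∨ n + 1 ≤ ∑ i, (f^[n + 1] ⊥ i : ℕ) := by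
    induction n with
    | zero =>
      rcases (step 0).eq_or_lt with h | h
      · exact Or.inl h.symm
      · exact Or.inr (Nat.succ_le_of_lt ((Nat.zero_le _).trans_lt (sum_val_lt_sum_val h)))
    | succ n ih =>
      rcases (step (n + 1)).eq_or_lt with h | h
      · left
        rw [iterate_succ_apply' f (n + 1)] at h
        exact h.symm
      · rcases ih with ih | ih
        · left
          rw [iterate_succ_apply', ih]
          exact ih
        · exact Or.inr (Nat.succ_le_of_lt (ih.trans_lt (sum_val_lt_sum_val h)))
  refine (key k).resolve_right fun h => ?_
  have : ∑ i, (f^[k + 1] ⊥ i : ℕ) ≤ ∑ _i : Fin k, 1 := sum_le_sum fun i _ => by omega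
  simp only [sum_const, card_univ, Fintype.card_fin, smul_eq_mul, mul_one] at this
  omega

theorem succeeds_iterate_bot {k : ℕ} {f : Grid 2 k → Grid 2 k} (hf : Monotone f) :
    (QueryAlg.iterate k (⊥ : Grid 2 k)).Succeeds f := by
  rw [QueryAlg.Succeeds, QueryAlg.run_iterate]
  exact isFixedPt_iterate_bot hf

theorem detQueryComplexity_le (k : ℕ) : detQueryComplexity 2 k ≤ k :=
  iInf₂_le_of_le (QueryAlg.iterate k ⊥) (fun _ hf => succeeds_iterate_bot hf)
    (iSup₂_le fun f _ => by rw [QueryAlg.numQueries_iterate])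

theorem randQueryComplexity_le (k : ℕ) : randQueryComplexity 2 k ≤ k := by
  classical
  refine iInf₂_le_of_le (PMF.pure (QueryAlg.iterate k ⊥)) (fun f hf => ?_)
    (iSup₂_le fun f _ => ?_)
  · have hmem : QueryAlg.iterate k ⊥ ∈ {T : QueryAlg (Grid 2 k) | T.Succeeds f} :=
      succeeds_iterate_bot hf
    rw [RandQueryAlg.successProb, PMF.toOuterMeasure_pure_apply, if_pos hmem]
    exact ENNReal.div_le_of_le_mul (by norm_num)
  · rw [RandQueryAlg.expectedQueries, tsum_eq_single (QueryAlg.iterate k ⊥)]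
    · simp [QueryAlg.numQueries_iterate]
    · intro T hT
      simp [PMF.pure_apply, hT]

/-! ### The hard family of monotone functions -/

/-- A monotone function whose only fixed point is `a`. At every vertex it corrects the first wrong
coordinate among those equal to `0`, and the first wrong one among those equal to `1`. -/
def hardFun {k : ℕ} (a v : Grid 2 k) : Grid 2 k := fun j =>
  if ∀ i < j, v i = v j → a i = v i then a j else v j

/-- Zeros of `w` are zeros of `v`, so an earlier wrong 0 in `w` is also one in `v`; dually for ones.
-/
theorem monotone_hardFun {k : ℕ} (a : Grid 2 k) : Monotone (hardFun a) := by
  intro v w hvw j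
  have hj : v j ≤ w j := hvw j
  simp only [hardFun]
  by_cases hv : ∀ i < j, v i = v j → a i = v i <;>
    by_cases hw : ∀ i < j, w i = w j → a i = w i
  · rw [if_pos hv, if_pos hw]
  · rw [if_pos hv, if_neg hw]
    push Not at hw
    obtain ⟨i, hij, hi, hai⟩ := hw
    have h1 := imp_iff_not_or.1 (hv i hij)
    have h2 : v i ≤ w i := hvw i
    omega
  · rw [if_neg hv, if_pos hw]
    push Not at hv
    obtain ⟨i, hij, hi, hai⟩ := hv
    have h1 := imp_iff_not_or.1 (hw i hij)
    have h2 : v i ≤ w i := hvw i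
    omega
  · rwa [if_neg hv, if_neg hw]

theorem eq_of_isFixedPt_hardFun {k : ℕ} {a x : Grid 2 k} (h : IsFixedPt (hardFun a) x) :
    x = a := by
  have key (n : ℕ) (j : Fin k) (hj : (j : ℕ) < n) : a j = x j := by
    induction n generalizing j with
    | zero => omega
    | succ n ih =>
      have hx := congrFun h j
      rwa [hardFun, if_pos fun i hij _ => ih i (by omega)] at hx
  exact funext fun j => (key k j j.isLt).symm

/-- On the subcube with base point `a` and free coordinates `U`, the first coordinate where
`v` has value `b` and is wrong does not depend on the free coordinates. -/
def Resolved {k : ℕ} (v : Grid 2 k) (b : Fin 2) (U : Finset (Fin k)) (a : Grid 2 k) : Prop :=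
  ∀ i ∈ U, v i = b → ∃ j ∉ U, j < i ∧ v j = b ∧ a j ≠ b

theorem Resolved.erase {k : ℕ} {v : Grid 2 k} {b : Fin 2} {U : Finset (Fin k)} {a : Grid 2 k}
    (h : Resolved v b U a) {i : Fin k} (hi : i ∈ U) (c : Fin 2) :
    Resolved v b (U.erase i) (update a i c) := by
  intro l hl hv
  obtain ⟨j, hj, hjl, hvj, haj⟩ := h l (mem_of_mem_erase hl) hv
  have hji : j ≠ i := fun h => hj (h ▸ hi)
  exact ⟨j, fun h => hj (mem_of_mem_erase h), hjl, hvj, by rwa [update_of_ne hji]⟩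

/-- A test that could reach a free coordinate already fails at a fixed wrong one before it. -/
theorem hardFun_piecewise {k : ℕ} {v : Grid 2 k} {U : Finset (Fin k)} {a : Grid 2 k}
    (h : ∀ b, Resolved v b U a) (x : Grid 2 k) :
    hardFun (U.piecewise x a) v = hardFun a v := by
  have wrong {j i : Fin k} (hi : i ∈ U) (hij : i ≤ j) (hv : v i = v j) (y : Grid 2 k)
      (hy : ∀ l ∉ U, y l = a l) : ¬ ∀ l < j, v l = v j → y l = v l := by
    obtain ⟨l, hl, hli, hvl, hal⟩ := h (v j) i hi hv
    exact fun H => hal (by rw [← hy l hl, H l (hli.trans_le hij) hvl, hvl])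
  have hpw (l) (hl : l ∉ U) : U.piecewise x a l = a l := piecewise_eq_of_notMem _ _ _ hl
  funext j
  simp only [hardFun]
  by_cases hU : ∃ i ∈ U, i ≤ j ∧ v i = v j
  · obtain ⟨i, hi, hij, hv⟩ := hU
    rw [if_neg (wrong hi hij hv _ hpw), if_neg (wrong hi hij hv _ fun _ _ => rfl)]
  · push Not at hU
    have hj : j ∉ U := fun hj => hU j hj le_rfl rfl
    rw [hpw j hj]
    congr 1
    refine propext (forall₃_congr fun i hij hv => ?_)
    rw [hpw i fun hi => hU i hi hij.le hv]

/-! ### Averaging over subcubes -/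

theorem sum_update_add_sum_update {k : ℕ} (F : Grid 2 k → ℕ) (i : Fin k) (b : Fin 2) :
    ∑ x, F (update x i b) + ∑ x, F (update x i (1 - b)) = 2 * ∑ x, F x := by
  have hinv : Involutive fun x : Grid 2 k => update x i (1 - x i) := fun x => by
    simp
  have hflip : ∑ x, F (update x i (1 - x i)) = ∑ x, F x :=
    Equiv.sum_comp hinv.toPerm F
  have hdouble : 2 * ∑ x, F x = ∑ x, F x + ∑ x, F (update x i (1 - x i)) := by
    rw [hflip, two_mul]
  rw [hdouble, ← sum_add_distrib, ← sum_add_distrib]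
  refine sum_congr rfl fun x _ => ?_
  rcases eq_or_ne (x i) b with h | h
  · rw [← h, update_eq_self]
  · have h' : x i = 1 - b := by omega
    have hb : 1 - (1 - b) = b := by omega
    rw [h', hb, ← h', update_eq_self, add_comm]

theorem piecewise_erase_update {k : ℕ} {U : Finset (Fin k)} {i : Fin k} (hi : i ∈ U)
    (x a : Grid 2 k) (b : Fin 2) :
    (U.erase i).piecewise x (update a i b) = U.piecewise (update x i b) a := by
  funext j
  rcases eq_or_ne j i with rfl | hj
  · simp [hi]
  · by_cases hU : j ∈ U <;> simp [hU, hj]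

/-- Summing over the whole cube gives averages over all subcubes the same denominator `2 ^ k`. -/
theorem sum_piecewise_split {k : ℕ} (F : Grid 2 k → ℕ) {U : Finset (Fin k)} {i : Fin k}
    (hi : i ∈ U) (a : Grid 2 k) (b : Fin 2) :
    ∑ x, F ((U.erase i).piecewise x (update a i b)) +
      ∑ x, F ((U.erase i).piecewise x (update a i (1 - b))) =
      2 * ∑ x, F (U.piecewise x a) := by
  simp only [piecewise_erase_update hi]
  exact sum_update_add_sum_update (fun x => F (U.piecewise x a)) i b

/-- Searching for the first wrong coordinate of value `b` reveals two coordinates on average. -/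
theorem card_mul_card_le_of_resolved {k : ℕ} (F : Grid 2 k → ℕ) (v : Grid 2 k) (b : Fin 2)
    (c : ℕ) (Q : Finset (Fin k) → Grid 2 k → Prop)
    (hQ : ∀ U a, Q U a → ∀ i ∈ U, ∀ d, Q (U.erase i) (update a i d))
    (h : ∀ U a, Q U a → Resolved v b U a →
      2 ^ k * #U ≤ ∑ x, F (U.piecewise x a) + c * 2 ^ k)
    (U : Finset (Fin k)) (a : Grid 2 k) (hUa : Q U a) :
    2 ^ k * #U ≤ ∑ x, F (U.piecewise x a) + (c + 2) * 2 ^ k := by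
  induction hn : #U generalizing U a with
  | zero => simp
  | succ n ih =>
    by_cases hr : Resolved v b U a
    · have := h U a hUa hr
      rw [hn] at this
      exact this.trans (by gcongr; omega)
    have hne : (U.filter fun i => v i = b).Nonempty := by
      simp only [Resolved] at hr
      push Not at hr
      obtain ⟨i, hi, hv, -⟩ := hr
      exact ⟨i, mem_filter.2 ⟨hi, hv⟩⟩
    obtain ⟨i, hi, hmin⟩ := exists_min_image _ id hne
    obtain ⟨hiU, hvi⟩ := mem_filter.1 hi
    have hcard : #(U.erase i) = n := by rw [card_erase_of_mem hiU, hn]; rfl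
    -- If `a i = b` the scan goes on (loss `c + 2`), otherwise it is over (loss `c`). The mean `c +
    -- 1`, plus one for `i` itself, is `c + 2`.
    have hsame := ih _ _ (hQ U a hUa i hiU b) hcard
    have hdiff := h _ _ (hQ U a hUa i hiU (1 - b)) (by
      intro l hl hvl
      refine ⟨i, notMem_erase i U, ?_, hvi, by rw [update_self]; omega⟩
      have hle : i ≤ l := hmin l (mem_filter.2 ⟨mem_of_mem_erase hl, hvl⟩)
      exact lt_of_le_of_ne hle (ne_of_mem_erase hl).symm)
    have hsplit := sum_piecewise_split F hiU a b
    rw [hcard] at hdiff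
    nlinarith

/-- The cost of an algorithm on `hardFun a`, with a penalty for not finding the fixed point. -/
def cost {k : ℕ} (T : QueryAlg (Grid 2 k)) (a : Grid 2 k) : ℕ :=
  4 * T.numQueries (hardFun a) + if T.run (hardFun a) = a then 0 else 2 * k

theorem card_mul_card_le_sum_cost {k : ℕ} (T : QueryAlg (Grid 2 k)) (U : Finset (Fin k))
    (a : Grid 2 k) : 2 ^ k * #U ≤ ∑ x, cost T (U.piecewise x a) := by
  induction T generalizing U a with
  | output y =>
    rcases U.eq_empty_or_nonempty with rfl | ⟨i, hi⟩
    · simp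
    have hU : #U ≤ k := by simpa using card_le_univ U
    -- The output is wrong on the half with `a i ≠ y i`; penalty `2 * k` there averages to `k ≥ #U`.
    have hsplit := sum_piecewise_split (cost (.output y)) hi a (1 - y i)
    have hfail : ∑ x, cost (.output y) ((U.erase i).piecewise x (update a i (1 - y i))) =
        2 * (2 ^ k * k) := by
      have hcost (x : Grid 2 k) :
          cost (.output y) ((U.erase i).piecewise x (update a i (1 - y i))) = 2 * k := by
        have hne : y ≠ (U.erase i).piecewise x (update a i (1 - y i)) := fun h => by
          have := congrFun h i
          rw [piecewise_eq_of_notMem _ _ _ (notMem_erase i U), update_self] at this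
          omega
        simp [cost, QueryAlg.numQueries, QueryAlg.run, hne]
      simp [hcost, mul_left_comm]
    have := Nat.mul_le_mul_left (2 ^ k) hU
    omega
  | query v next ih =>
    let F (x : Grid 2 k) : ℕ := cost (next (hardFun x v)) x
    have hF (x : Grid 2 k) : cost (.query v next) x = F x + 4 := by
      rw [cost, QueryAlg.numQueries, QueryAlg.run, mul_add, add_right_comm]
      rfl
    -- The scan for 1 is nested in the scan for 0 and keeps `Resolved v 0`. The total loss 4 is the
    -- weight of a query in `cost`.
    have hone := card_mul_card_le_of_resolved F v 1 0 (Resolved v 0)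
      (fun U a h i hi d => h.erase hi d) (fun U a h0 h1 => by
        have hres (b : Fin 2) : Resolved v b U a := by
          fin_cases b
          · exact h0
          · exact h1
        have := ih (hardFun a v) U a
        simpa [F, hardFun_piecewise hres] using this)
    have hzero := card_mul_card_le_of_resolved F v 0 2 (fun _ _ => True)
      (fun _ _ _ _ _ _ => trivial) (fun U a _ h0 => by simpa using hone U a h0) U a trivial
    simp only [hF, sum_add_distrib, sum_const, card_univ, Fintype.card_pi, Fintype.card_fin,
      prod_const, smul_eq_mul]
    linarith

theorem pow_mul_le_sum_cost {k : ℕ} (T : QueryAlg (Grid 2 k)) :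
    2 ^ k * k ≤ ∑ a, cost T a := by
  simpa using card_mul_card_le_sum_cost T univ ⊥

/-! ### Lower bounds -/

theorem exists_le_numQueries {k : ℕ} {T : QueryAlg (Grid 2 k)}
    (hT : ∀ f : Grid 2 k → Grid 2 k, Monotone f → T.Succeeds f) :
    ∃ a : Grid 2 k, k ≤ 4 * T.numQueries (hardFun a) := by
  have hsum := pow_mul_le_sum_cost T
  have hrun (a : Grid 2 k) : T.run (hardFun a) = a :=
    eq_of_isFixedPt_hardFun (hT _ (monotone_hardFun a))
  obtain ⟨a, -, ha⟩ := exists_le_of_sum_le (s := (univ : Finset (Grid 2 k))) univ_nonempty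
    (f := fun _ => k) (g := cost T) (by simpa using hsum)
  exact ⟨a, by simpa [cost, hrun] using ha⟩

theorem le_detQueryComplexity (k : ℕ) :
    (((k + 3) / 4 : ℕ) : ℕ∞) ≤ detQueryComplexity 2 k := by
  refine le_iInf₂ fun T hT => ?_
  obtain ⟨a, ha⟩ := exists_le_numQueries hT
  refine le_iSup₂_of_le (hardFun a) (monotone_hardFun a) ?_
  exact_mod_cast (by omega : (k + 3) / 4 ≤ T.numQueries (hardFun a))

/-- The success term stands on the left to avoid truncated subtraction in `ℝ≥0∞`. -/
theorem cost_add_le {k : ℕ} (T : QueryAlg (Grid 2 k)) (a : Grid 2 k) :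
    (cost T a : ℝ≥0∞) + 2 * k * Set.indicator {T | T.Succeeds (hardFun a)} 1 T ≤
      4 * T.numQueries (hardFun a) + 2 * k := by
  classical
  by_cases h : T.Succeeds (hardFun a)
  · have hrun : T.run (hardFun a) = a := eq_of_isFixedPt_hardFun h
    simp [cost, h, hrun]
  · simp only [cost, Set.indicator, Set.mem_ofPred_eq, h, if_false, mul_zero, add_zero]
    split_ifs <;> simp

theorem pow_mul_le_sum_expectedQueries {k : ℕ} (A : RandQueryAlg (Grid 2 k)) :
    (2 : ℝ≥0∞) ^ k * k + ∑ a, 2 * k * A.successProb (hardFun a) ≤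
      ∑ a, (4 * A.expectedQueries (hardFun a) + 2 * k) := by
  have hsum (c : ℝ≥0∞) : ∑' T, A T * c = c := by
    rw [ENNReal.tsum_mul_right, A.tsum_coe, one_mul]
  have hsucc (a : Grid 2 k) : 2 * k * A.successProb (hardFun a) =
      ∑' T, A T * (2 * k * Set.indicator {T | T.Succeeds (hardFun a)} 1 T) := by
    rw [RandQueryAlg.successProb, PMF.toOuterMeasure_apply, ← ENNReal.tsum_mul_left]
    refine tsum_congr fun T => ?_
    by_cases h : T.Succeeds (hardFun a) <;> simp [Set.indicator, h, mul_comm]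
  have hexp (a : Grid 2 k) : 4 * A.expectedQueries (hardFun a) + 2 * k =
      ∑' T, A T * (4 * T.numQueries (hardFun a) + 2 * k) := by
    conv_lhs => rw [← hsum (2 * k), RandQueryAlg.expectedQueries, ← ENNReal.tsum_mul_left,
      ← ENNReal.tsum_add]
    exact tsum_congr fun T => by ring
  simp only [hsucc, hexp]
  rw [← hsum (2 ^ k * k), ← Summable.tsum_finsetSum fun _ _ => ENNReal.summable,
    ← Summable.tsum_finsetSum fun _ _ => ENNReal.summable, ← ENNReal.tsum_add]
  refine ENNReal.tsum_le_tsum fun T => ?_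
  rw [← mul_sum _ _ (A T), ← mul_sum _ _ (A T), ← mul_add]
  gcongr
  calc _ ≤ ∑ a, (cost T a : ℝ≥0∞) +
        ∑ a, (2 * k * Set.indicator {T | T.Succeeds (hardFun a)} 1 T : ℝ≥0∞) := by
        gcongr
        exact_mod_cast pow_mul_le_sum_cost T
    _ ≤ _ := by
      rw [← sum_add_distrib]
      exact sum_le_sum fun a _ => cost_add_le T a

theorem le_randQueryComplexity (k : ℕ) : (k : ℝ≥0∞) / 5 ≤ randQueryComplexity 2 k := by
  refine le_iInf₂ fun A hA => ?_
  set s := ⨆ (f : Grid 2 k → Grid 2 k) (_ : Monotone f), A.expectedQueries f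
  have hle (a : Grid 2 k) : A.expectedQueries (hardFun a) ≤ s :=
    le_iSup₂_of_le (hardFun a) (monotone_hardFun a) le_rfl
  have hsum : (2 : ℝ≥0∞) ^ k * k + 2 ^ k * (2 * k * (9 / 10)) ≤ 2 ^ k * (4 * s + 2 * k) :=
    calc _ = (2 : ℝ≥0∞) ^ k * k + ∑ _a : Grid 2 k, (2 * k * (9 / 10) : ℝ≥0∞) := by simp
      _ ≤ (2 : ℝ≥0∞) ^ k * k + ∑ a, 2 * k * A.successProb (hardFun a) := by
        gcongr with a
        exact hA _ (monotone_hardFun a)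
      _ ≤ ∑ a, (4 * A.expectedQueries (hardFun a) + 2 * k) := pow_mul_le_sum_expectedQueries A
      _ ≤ ∑ _a : Grid 2 k, (4 * s + 2 * k) := by
        gcongr with a
        exact hle a
      _ = _ := by simp [mul_add]
  rw [← mul_add, ENNReal.mul_le_mul_iff_right (by simp) (by simp)] at hsum
  clear_value s
  rcases eq_or_ne s ⊤ with h | h
  · rw [h]; exact le_top
  lift s to ℝ≥0 using h
  -- Failure probability 1/10 costs at most `k / 5`, which leaves `4 * s ≥ 4 * k / 5`.
  have hreal : (k : ℝ≥0) + 2 * k * (9 / 10) ≤ 4 * s + 2 * k := by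
    rw [← ENNReal.coe_le_coe]
    push_cast
    rwa [ENNReal.coe_div (by norm_num)]
  have hdiv : (k : ℝ≥0) / 5 ≤ s := by
    rw [← NNReal.coe_le_coe] at hreal ⊢
    push_cast at hreal ⊢
    linarith
  rw [← ENNReal.coe_le_coe, ENNReal.coe_div (by norm_num)] at hdiv
  simpa using hdiv

end Tarski

theorem mainTheorem2 :
    ∃ c C : ℝ≥0, 0 < c ∧ 0 < C ∧ ∀ k : ℕ,
      ((c : ℝ≥0∞) * (k : ℝ≥0∞) ≤ Tarski.randQueryComplexity 2 k ∧
        Tarski.randQueryComplexity 2 k ≤ (C : ℝ≥0∞) * (k : ℝ≥0∞)) ∧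
      ((c : ℝ≥0∞) * (k : ℝ≥0∞) ≤ (Tarski.detQueryComplexity 2 k : ℝ≥0∞) ∧
        (Tarski.detQueryComplexity 2 k : ℝ≥0∞) ≤ (C : ℝ≥0∞) * (k : ℝ≥0∞)) := by
  have hc (k : ℕ) : ((5⁻¹ : ℝ≥0) : ℝ≥0∞) * k = (k : ℝ≥0∞) / 5 := by
    rw [ENNReal.coe_inv (by norm_num), mul_comm, div_eq_mul_inv]
    rfl
  refine ⟨5⁻¹, 1, by norm_num, one_pos, fun k => ⟨⟨?_, ?_⟩, ?_, ?_⟩⟩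
  · rw [hc]
    exact Tarski.le_randQueryComplexity k
  · simpa using Tarski.randQueryComplexity_le k
  · have hD := ENat.toENNReal_le.2 (Tarski.le_detQueryComplexity k)
    rw [ENat.toENNReal_coe] at hD
    refine le_trans ?_ hD
    rw [hc]
    refine ENNReal.div_le_of_le_mul ?_
    exact_mod_cast (by omega : k ≤ (k + 3) / 4 * 5)
  · simpa using ENat.toENNReal_le.2 (Tarski.detQueryComplexity_le k)
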